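/- **Theorem (discrete Farkas lemma).** Let $m,n\ge 0$, let $A\in\mathbb N^{m\times n}$ have columns $A_1,\dots,A_n\in\mathbb N^m$, and let $b\in\mathbb N^m$ (with $0\in\mathbb N$). Write $z^a=z_1^{a_1}\cdots z_m^{a_m}$ for $a\in\mathbb N^m$, and let $\mathcal C_A\subseteq\mathbb R[z_1,\dots,z_m]$ be the convex cone (containing $0$) generated by the polynomials $z^\alpha(z^{A_j}-1)$, $\alpha\in\mathbb N^m$, $1\le j\le n$. Let $f:\mathbb Z^n\to\mathbb Z^m$, $f(x)=Ax$; let $\mathbb D=\operatorname{Hom}_{\mathbb Z}(-,\mathbb Z)$, and let $\eta_M:M\to\mathbb D^2(M)$ be the evaluation map. The following are equivalent: (a) There is $x\in\mathbb N^n$ with $Ax=b$. (b) $z^b-1\in\mathcal C_A$; equivalently, $z^b-1=\sum_{j=1}^n Q_j\,(z^{A_j}-1)$ for some $Q_j\in\mathbb R[z]$ with nonnegative coefficients; equivalently, such an identity holds with $Q_j\in\mathbb N[z]$. (c) The ethic square holds at $b$ when restricted to the positive submonoids $\mathbb N^n\subset\mathbb Z^n$ and $\mathbb N^m\subset\mathbb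 Z^m$. By this we mean that $\mathbb D^2(f)\circ\eta_{\mathbb Z^n}=\eta_{\mathbb Z^m}\circ f$ on $\mathbb N^n$ (which is automatic, since $\eta$ is natural), and that no positive dual evaluation compatible with the relations sends $z^b-1$ to a negative value: every linear functional $\Phi:\mathbb R[z]\to\mathbb R$ with $\Phi\ge0$ on $\mathcal C_A$ satisfies $\Phi(z^b-1)\ge 0$. Equivalently, the same holds with integer-valued evaluations, that is, with the additive maps $\Phi:\mathbb Z[z]\to\mathbb Z$ that are nonnegative on every $z^\alpha(z^{A_j}-1)$. Moreover, the degrees of the $Q_j$ are bounded by $$b^*=\sum_{i=1}^m b_i-\min_{1\le k\le n}\sum_{i=1}^m A_{ik}$$ in the following sense. If (a)–(c) hold, then the $Q_j\in\mathbb N[z]$ in (b) can be chosen such that $\deg Q_j\le b^*$ for every $j$ with $Q_j\neq0$. Furthermore, for every representation as in (b) with $Q_j\in\mathbb R[z]$ having nonnegative coefficients, $\deg Q_j\le b^*$ for every $j$ with $A_j\ne0$ and $Q_j\neq 0$. -/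

import Mathlib

open MvPolynomial

namespace DiscreteFarkas

/-- The exponent vector `a ∈ ℕ^m`, seen as an exponent of `MvPolynomial (Fin m) S`. -/
noncomputable def expo {m : ℕ} (a : Fin m → ℕ) : Fin m →₀ ℕ := Finsupp.equivFunOnFinite.symm a

/-- The monomial `z^a = z_1^{a_1} ⋯ z_m^{a_m}` with coefficient `1`. -/
noncomputable def zmon (S : Type) [CommRing S] {m : ℕ} (a : Fin m → ℕ) : MvPolynomial (Fin m) S :=
  monomial (expo a) 1

/-- The binomial `z^a - 1`. For `a = A_j` (the `j`-th column of `A`) it is the basic relation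
`r_j`, and for `a = b` it is the target `u_b`. -/
noncomputable def binom (S : Type) [CommRing S] {m : ℕ} (a : Fin m → ℕ) : MvPolynomial (Fin m) S :=
  zmon S a - 1

/-- The set of all multiplicative shifts `z^α (z^{A_j} - 1)` of the basic relations. -/
def shifts (S : Type) [CommRing S] {m n : ℕ} (A : Matrix (Fin m) (Fin n) ℕ) :
    Set (MvPolynomial (Fin m) S) :=
  {p | ∃ (α : Fin m → ℕ) (j : Fin n), p = zmon S α * binom S (A.col j)}

/-- The positive binomial cone `𝓒_A ⊆ ℤ[z] ⊗ ℝ = ℝ[z]`: the convex cone (containing `0`) generated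
by all the shifts of the basic relations. -/
noncomputable def relCone {m n : ℕ} (A : Matrix (Fin m) (Fin n) ℕ) :
    PointedCone ℝ (MvPolynomial (Fin m) ℝ) :=
  PointedCone.hull ℝ (shifts ℝ A)

/-- `Q_1, …, Q_n ∈ ℝ[z]` have nonnegative coefficients and `z^b - 1 = ∑_j Q_j (z^{A_j} - 1)`. -/
def IsRealRep {m n : ℕ} (A : Matrix (Fin m) (Fin n) ℕ) (b : Fin m → ℕ)
    (Q : Fin n → MvPolynomial (Fin m) ℝ) : Prop :=
  (∀ j α, 0 ≤ (Q j).coeff α) ∧ binom ℝ b = ∑ j, Q j * binom ℝ (A.col j)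

/-- `Q_1, …, Q_n ∈ ℕ[z]` satisfy `z^b - 1 = ∑_j Q_j (z^{A_j} - 1)` in `ℤ[z]`. -/
def IsNatRep {m n : ℕ} (A : Matrix (Fin m) (Fin n) ℕ) (b : Fin m → ℕ)
    (Q : Fin n → MvPolynomial (Fin m) ℕ) : Prop :=
  binom ℤ b = ∑ j, MvPolynomial.map (Nat.castRingHom ℤ) (Q j) * binom ℤ (A.col j)

/-- The homomorphism `f : ℤ^n → ℤ^m`, `f x = A x`. -/
noncomputable def linMap {m n : ℕ} (A : Matrix (Fin m) (Fin n) ℕ) :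
    (Fin n → ℤ) →ₗ[ℤ] (Fin m → ℤ) :=
  (A.map (Nat.cast : ℕ → ℤ)).mulVecLin

/-- The square `𝔻²(f) ∘ η_X = η_Y ∘ f`, where `𝔻 = Hom(-, ℤ)` and `η` is the evaluation unit,
on the elements of the positive submonoid `ℕ^n ⊆ ℤ^n`. -/
def SquareOnPositive {m n : ℕ} (A : Matrix (Fin m) (Fin n) ℕ) : Prop :=
  ∀ x : Fin n → ℕ,
    (linMap A).dualMap.dualMap (Module.Dual.eval ℤ (Fin n → ℤ) fun j => (x j : ℤ)) =
      Module.Dual.eval ℤ (Fin m → ℤ) (linMap A fun j => (x j : ℤ))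

/-- The positive dual evaluations compatible with the relations: the linear functionals on `ℝ[z]`
that are nonnegative on `𝓒_A`. -/
def posEval {m n : ℕ} (A : Matrix (Fin m) (Fin n) ℕ) :
    Set (Module.Dual ℝ (MvPolynomial (Fin m) ℝ)) :=
  {Φ | ∀ p ∈ relCone A, 0 ≤ Φ p}

/-- The integer-valued dual evaluations: the additive functionals `ℤ[z] → ℤ` that are nonnegative
on all the shifts of the basic relations. -/
def posEvalInt {m n : ℕ} (A : Matrix (Fin m) (Fin n) ℕ) :
    Set (Module.Dual ℤ (MvPolynomial (Fin m) ℤ)) :=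
  {Φ | ∀ p ∈ shifts ℤ A, 0 ≤ Φ p}

/-- The ethic condition at `b`, restricted to the positive submonoids: the square commutes there
(this part is automatic, `η` being natural), and no positive dual evaluation compatible with the
relations sends `z^b - 1` to a negative value. -/
def EthicOnPositive {m n : ℕ} (A : Matrix (Fin m) (Fin n) ℕ) (b : Fin m → ℕ) : Prop :=
  SquareOnPositive A ∧ ∀ Φ ∈ posEval A, 0 ≤ Φ (binom ℝ b)

/-- The same condition, tested by integer-valued dual evaluations. -/
def EthicOnPositiveInt {m n : ℕ} (A : Matrix (Fin m) (Fin n) ℕ) (b : Fin m → ℕ) : Prop :=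
  SquareOnPositive A ∧ ∀ Φ ∈ posEvalInt A, 0 ≤ Φ (binom ℤ b)

/-- The degree bound `b* = ∑_i b_i - min_k ∑_i A_{ik}`, as an integer (it may be negative). It is
used only when there is at least one column. -/
noncomputable def degBound {m n : ℕ} (A : Matrix (Fin m) (Fin n) ℕ) (b : Fin m → ℕ) : ℤ :=
  ((∑ i, b i : ℕ) : ℤ) - ((⨅ k, ∑ i, A i k : ℕ) : ℤ)

end DiscreteFarkas

namespace DiscreteFarkas

section Monomials

variable {S : Type} [CommRing S] {m n : ℕ}

/-! If `b` is a sum of columns, adding them one at a time gives a path from `0` to `b`; a step from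
`c` to `c + A_k` contributes `z^c (z^{A_k} - 1)`, and the telescoping sum is a representation over
`ℕ`. Conversely, the functional given on monomials by the indicator of the monoid generated by the
columns is nonnegative on all shifts, because that monoid is closed under adding columns, but equals
`-1` at `z^b - 1` when `b` lies outside. This explicit certificate takes only the values 0 and 1 on
monomials, so it settles the real and integer tests alike, without a separation theorem. The degree
bound uses another such functional, the indicator of large total degree. -/

theorem zmon_add (a b : Fin m → ℕ) : zmon S (a + b) = zmon S a * zmon S b := by
  have h : expo (a + b) = expo a + expo b := by ext i; simp [expo]
  simp [zmon, h, monomial_mul]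

theorem zmon_zero : zmon S (0 : Fin m → ℕ) = 1 := by
  have h : expo (0 : Fin m → ℕ) = 0 := by ext i; simp [expo]
  simp [zmon, h]

theorem zmon_coe (s : Fin m →₀ ℕ) : zmon S (s : Fin m → ℕ) = monomial s 1 := by
  have h : expo (s : Fin m → ℕ) = s := by ext i; simp [expo]
  simp [zmon, h]

theorem binom_add (a b : Fin m → ℕ) : binom S (a + b) = binom S a + zmon S a * binom S b := by
  simp only [binom, zmon_add]; ring

theorem mul_binom_eq_sum_shifts (q : MvPolynomial (Fin m) S) (a : Fin m → ℕ) :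
    q * binom S a = ∑ s ∈ q.support, q.coeff s • (zmon S (s : Fin m → ℕ) * binom S a) := by
  conv_lhs => rw [q.as_sum, Finset.sum_mul]
  refine Finset.sum_congr rfl fun s _ => ?_
  rw [zmon_coe, ← smul_mul_assoc, smul_monomial, smul_eq_mul, mul_one]

/-- The linear functional on polynomials taking the value `w a` at the monomial `z^a`. -/
noncomputable def weightFunctional (w : (Fin m → ℕ) → S) : Module.Dual S (MvPolynomial (Fin m) S) :=
  (basisMonomials (Fin m) S).constr S fun s => w s

theorem weightFunctional_zmon (w : (Fin m → ℕ) → S) (a : Fin m → ℕ) :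
    weightFunctional w (zmon S a) = w a := by
  have h := (basisMonomials (Fin m) S).constr_basis S (fun s => w s) (expo a)
  rw [coe_basisMonomials] at h
  exact h

theorem weightFunctional_binom (w : (Fin m → ℕ) → S) (a : Fin m → ℕ) :
    weightFunctional w (binom S a) = w a - w 0 := by
  rw [binom, map_sub, weightFunctional_zmon, ← zmon_zero, weightFunctional_zmon]

theorem weightFunctional_shift (w : (Fin m → ℕ) → S) (a b : Fin m → ℕ) :
    weightFunctional w (zmon S a * binom S b) = w (a + b) - w a := by
  rw [binom, mul_sub, mul_one, map_sub, ← zmon_add, weightFunctional_zmon, weightFunctional_zmon]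

end Monomials

variable {m n : ℕ} {A : Matrix (Fin m) (Fin n) ℕ} {b : Fin m → ℕ}

theorem squareOnPositive (A : Matrix (Fin m) (Fin n) ℕ) : SquareOnPositive A := fun _ => rfl

theorem mem_posEval_iff {Φ : Module.Dual ℝ (MvPolynomial (Fin m) ℝ)} :
    Φ ∈ posEval A ↔ ∀ p ∈ shifts ℝ A, 0 ≤ Φ p := by
  refine ⟨fun h p hp => h p (Submodule.subset_span hp), fun h p hp => ?_⟩
  induction hp using Submodule.span_induction with
  | mem p hp => exact h p hp
  | zero => simp
  | add p q _ _ hp hq => rw [map_add]; exact add_nonneg hp hq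
  | smul c p _ hp =>
    change 0 ≤ Φ ((c : ℝ) • p)
    rw [map_smul]
    exact mul_nonneg c.2 hp

theorem IsRealRep.binom_mem_relCone {Q : Fin n → MvPolynomial (Fin m) ℝ} (h : IsRealRep A b Q) :
    binom ℝ b ∈ relCone A := by
  rw [h.2]
  refine Submodule.sum_mem _ fun j _ => ?_
  rw [mul_binom_eq_sum_shifts]
  refine Submodule.sum_mem _ fun s _ => ?_
  exact Submodule.smul_mem _ (⟨_, h.1 j s⟩ : {c : ℝ // 0 ≤ c})
    (Submodule.subset_span ⟨_, j, rfl⟩)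

/-- The monomials of the multipliers with nonzero relation have degree bounded by the target. -/
theorem IsRealRep.degree_add_le {Q : Fin n → MvPolynomial (Fin m) ℝ} (h : IsRealRep A b Q)
    {j : Fin n} (hj : A.col j ≠ 0) {s : Fin m →₀ ℕ} (hs : s ∈ (Q j).support) :
    ∑ i, s i + ∑ i, A i j ≤ ∑ i, b i := by
  classical
  set N := ∑ i, s i + ∑ i, A i j with hN
  have hpos : 0 < ∑ i, A i j := by
    obtain ⟨i, hi⟩ := Function.ne_iff.mp hj
    exact Finset.sum_pos' (fun _ _ => Nat.zero_le _) ⟨i, Finset.mem_univ i, Nat.pos_of_ne_zero hi⟩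
  -- Adding a column never lowers the total degree, so this weight is nonnegative on every shift. It
  -- jumps from 0 to 1 on `z^s (z^{A_j} - 1)`, because `A_j ≠ 0`; no other term can cancel this
  -- jump, which forces `w b = 1`.
  let w : (Fin m → ℕ) → ℝ := fun a => if N ≤ ∑ i, a i then 1 else 0
  have hmono (a c : Fin m → ℕ) : 0 ≤ w (a + c) - w a := by
    simp only [w, Pi.add_apply, Finset.sum_add_distrib]
    split_ifs <;> first | omega | norm_num
  have hterm (k : Fin n) (t : Fin m →₀ ℕ) : 0 ≤ (Q k).coeff t * (w (t + A.col k) - w t) :=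
    mul_nonneg (h.1 k t) (hmono _ _)
  have hval : w b - w 0 =
      ∑ k, ∑ t ∈ (Q k).support, (Q k).coeff t * (w (t + A.col k) - w t) := by
    rw [← weightFunctional_binom, h.2, map_sum]
    refine Finset.sum_congr rfl fun k _ => ?_
    rw [mul_binom_eq_sum_shifts, map_sum]
    refine Finset.sum_congr rfl fun t _ => ?_
    rw [map_smul, weightFunctional_shift, smul_eq_mul]
  have hstep : w (s + A.col j) - w s = 1 := by
    have h₁ : w (s + A.col j) = 1 :=
      if_pos (by simp [hN, Matrix.col_apply, Finset.sum_add_distrib])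
    have h₂ : w s = 0 := if_neg (by omega)
    rw [h₁, h₂, sub_zero]
  have hlt : 0 < w b - w 0 := by
    rw [hval]
    refine Finset.sum_pos' (fun k _ => Finset.sum_nonneg fun t _ => hterm k t)
      ⟨j, Finset.mem_univ j, Finset.sum_pos' (fun t _ => hterm j t) ⟨s, hs, ?_⟩⟩
    rw [hstep, mul_one]
    exact lt_of_le_of_ne (h.1 j s) (Ne.symm (mem_support_iff.mp hs))
  by_contra hb
  have hw0 : 0 ≤ w 0 := by simp only [w]; split_ifs <;> norm_num
  have hwb : w b = 0 := if_neg hb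
  linarith

theorem totalDegree_le_degBound {R : Type} [CommSemiring R] {q : MvPolynomial (Fin m) R}
    (hq : q ≠ 0) (j : Fin n)
    (h : ∀ s ∈ q.support, ∑ i, s i + ∑ i, A i j ≤ ∑ i, b i) :
    (q.totalDegree : ℤ) ≤ degBound A b := by
  have hinf : (⨅ k, ∑ i, A i k : ℕ) ≤ ∑ i, A i j := ciInf_le (OrderBot.bddBelow _) j
  obtain ⟨s, hs⟩ := support_nonempty.mpr hq
  have hdeg : q.totalDegree ≤ ∑ i, b i - ∑ i, A i j := by
    refine Finset.sup_le fun t ht => ?_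
    rw [Finsupp.sum_fintype _ _ fun _ => rfl]
    have := h t ht
    omega
  -- The subtraction in `hdeg` is truncated; a monomial of `q` shows that nothing is cut off.
  have := h s hs
  unfold degBound
  omega

/-- The degree bound is carried through the induction: the new monomial `z^c` attains it with
equality, and the older ones keep it because the target only grows. -/
theorem exists_isNatRep_of_mem_closure (hb : b ∈ AddSubmonoid.closure (Set.range A.col)) :
    ∃ Q : Fin n → MvPolynomial (Fin m) ℕ, IsNatRep A b Q ∧
      ∀ j, ∀ s ∈ (Q j).support, ∑ i, s i + ∑ i, A i j ≤ ∑ i, b i := by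
  classical
  induction hb using AddSubmonoid.closure_induction_right with
  | zero => exact ⟨0, by simp [IsNatRep, binom, zmon_zero], by simp⟩
  | add_right c _ d hd ih =>
    obtain ⟨k, rfl⟩ := hd
    obtain ⟨Q, hQ, hdeg⟩ := ih
    refine ⟨Q + Pi.single k (monomial (expo c) 1), ?_, fun j s hs => ?_⟩
    · simp only [IsNatRep, Pi.add_apply, map_add, add_mul, Finset.sum_add_distrib] at hQ ⊢
      rw [binom_add, hQ, add_right_inj, Finset.sum_eq_single k (fun j _ hj => by simp [hj]) (by simp)]
      simp [zmon]
    · simp only [Pi.add_apply, Finset.sum_add_distrib]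
      rcases Finset.mem_union.mp (support_add hs) with hs | hs
      · exact (hdeg j s hs).trans (Nat.le_add_right _ _)
      · obtain rfl : j = k := by
          by_contra hj
          simp [hj] at hs
        rw [Pi.single_eq_same] at hs
        obtain rfl := Finset.mem_singleton.mp (support_monomial_subset hs)
        simp [expo, Matrix.col_apply]

theorem mulVec_mem_closure (A : Matrix (Fin m) (Fin n) ℕ) (x : Fin n → ℕ) :
    A.mulVec x ∈ AddSubmonoid.closure (Set.range A.col) := by
  have h : A.mulVec x = ∑ j, x j • A.col j := by
    ext i
    simp [Matrix.mulVec, dotProduct, Matrix.col_apply, mul_comm]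
  rw [h]
  exact sum_mem fun j _ => nsmul_mem (AddSubmonoid.subset_closure (Set.mem_range_self j)) _

theorem IsNatRep.isRealRep {Q : Fin n → MvPolynomial (Fin m) ℕ} (h : IsNatRep A b Q) :
    IsRealRep A b fun j => map (Nat.castRingHom ℝ) (Q j) := by
  refine ⟨fun j α => by simp [coeff_map], ?_⟩
  have hb (a : Fin m → ℕ) : map (Int.castRingHom ℝ) (binom ℤ a) = binom ℝ a := by
    simp [binom, zmon]
  have := congrArg (map (Int.castRingHom ℝ)) h
  simp only [map_sum, map_mul, hb, map_map] at this
  rw [this]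
  congr!

theorem IsNatRep.ethicOnPositiveInt {Q : Fin n → MvPolynomial (Fin m) ℕ} (h : IsNatRep A b Q) :
    EthicOnPositiveInt A b := by
  refine ⟨squareOnPositive A, fun Φ hΦ => ?_⟩
  rw [h, map_sum]
  refine Finset.sum_nonneg fun j _ => ?_
  rw [mul_binom_eq_sum_shifts, map_sum]
  refine Finset.sum_nonneg fun s _ => ?_
  rw [map_smul, coeff_map]
  exact mul_nonneg (by simp) (hΦ _ ⟨_, j, rfl⟩)

/-- The indicator weight of the monoid generated by the columns of `A`. -/
noncomputable def imageWeight (S : Type) [CommRing S] (A : Matrix (Fin m) (Fin n) ℕ)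
    (a : Fin m → ℕ) : S :=
  open Classical in if ∃ x : Fin n → ℕ, A.mulVec x = a then 1 else 0

section ImageWeight

variable {S : Type} [CommRing S] [PartialOrder S] [IsStrictOrderedRing S]

/-- If `α = A x`, then `α + A_j = A (x + e_j)` and the two weights cancel; otherwise `α` has weight
0. -/
theorem imageWeight_shift_nonneg {p : MvPolynomial (Fin m) S} (hp : p ∈ shifts S A) :
    0 ≤ weightFunctional (imageWeight S A) p := by
  classical
  obtain ⟨α, j, rfl⟩ := hp
  rw [weightFunctional_shift]
  unfold imageWeight
  by_cases h : ∃ x : Fin n → ℕ, A.mulVec x = α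
  · obtain ⟨x, rfl⟩ := h
    rw [if_pos ⟨x + Pi.single j 1, by rw [Matrix.mulVec_add, Matrix.mulVec_single_one]⟩,
      if_pos ⟨x, rfl⟩, sub_self]
  · rw [if_neg h, sub_zero]
    split_ifs <;> simp

theorem exists_mulVec_eq_of_imageWeight
    (h : 0 ≤ weightFunctional (imageWeight S A) (binom S b)) : ∃ x : Fin n → ℕ, A.mulVec x = b := by
  classical
  by_contra hb
  rw [weightFunctional_binom, imageWeight, imageWeight, if_neg hb,
    if_pos ⟨0, Matrix.mulVec_zero A⟩, zero_sub, neg_nonneg] at h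
  exact absurd h (not_le_of_gt zero_lt_one)

end ImageWeight

end DiscreteFarkas

theorem mainTheorem11 {m n : ℕ} (A : Matrix (Fin m) (Fin n) ℕ) (b : Fin m → ℕ) :
    List.TFAE
      [∃ x : Fin n → ℕ, A.mulVec x = b,
       DiscreteFarkas.binom ℝ b ∈ DiscreteFarkas.relCone A,
       ∃ Q : Fin n → MvPolynomial (Fin m) ℝ, DiscreteFarkas.IsRealRep A b Q,
       ∃ Q : Fin n → MvPolynomial (Fin m) ℕ, DiscreteFarkas.IsNatRep A b Q,
       DiscreteFarkas.EthicOnPositive A b,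
       DiscreteFarkas.EthicOnPositiveInt A b] ∧
    ((∃ x : Fin n → ℕ, A.mulVec x = b) →
      ∃ Q : Fin n → MvPolynomial (Fin m) ℕ, DiscreteFarkas.IsNatRep A b Q ∧
        ∀ j, Q j ≠ 0 → ((Q j).totalDegree : ℤ) ≤ DiscreteFarkas.degBound A b) ∧
    (∀ Q : Fin n → MvPolynomial (Fin m) ℝ, DiscreteFarkas.IsRealRep A b Q →
      ∀ j, A.col j ≠ 0 → Q j ≠ 0 →
        ((Q j).totalDegree : ℤ) ≤ DiscreteFarkas.degBound A b) := by
  have natRep (h : ∃ x : Fin n → ℕ, A.mulVec x = b) :=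
    DiscreteFarkas.exists_isNatRep_of_mem_closure (A := A) (b := b)
      (h.elim fun x hx => hx ▸ DiscreteFarkas.mulVec_mem_closure A x)
  refine ⟨?_, fun h => ?_, fun Q hQ j hj hQj => ?_⟩
  · tfae_have 1 → 4 := fun h => (natRep h).imp fun _ hQ => hQ.1
    tfae_have 4 → 3 := fun ⟨_, hQ⟩ => ⟨_, hQ.isRealRep⟩
    tfae_have 3 → 2 := fun ⟨_, hQ⟩ => hQ.binom_mem_relCone
    tfae_have 2 → 5 := fun h => ⟨DiscreteFarkas.squareOnPositive A, fun _ hΦ => hΦ _ h⟩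
    tfae_have 5 → 1 := fun h => DiscreteFarkas.exists_mulVec_eq_of_imageWeight
      (h.2 _ (DiscreteFarkas.mem_posEval_iff.mpr fun _ hp => DiscreteFarkas.imageWeight_shift_nonneg hp))
    tfae_have 4 → 6 := fun ⟨_, hQ⟩ => hQ.ethicOnPositiveInt
    tfae_have 6 → 1 := fun h => DiscreteFarkas.exists_mulVec_eq_of_imageWeight
      (h.2 _ fun _ hp => DiscreteFarkas.imageWeight_shift_nonneg hp)
    tfae_finish
  · obtain ⟨Q, hQ, hdeg⟩ := natRep h
    exact ⟨Q, hQ, fun j hj => DiscreteFarkas.totalDegree_le_degBound hj j (hdeg j)⟩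
  · exact DiscreteFarkas.totalDegree_le_degBound hQj j fun s hs => hQ.degree_add_le hj hs
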